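/- Let $\mathcal C$ be a semi-abelian category, i.e. a pointed, Barr exact, protomodular category with finite coproducts (pointed protomodular: for every object $A$ the kernel functor $K_A\colon \mathrm{Pt}_A(\mathcal C)\to\mathcal C$, $(b\colon B\to A,\ s,\ bs=1_A)\mapsto \mathrm{Ker}(b)$, on the category of split epimorphisms over $A$ with chosen section, reflects isomorphisms). A monomorphism is called normal if it is an equivalence class of some internal equivalence relation on its codomain. The category $\mathcal C$ is called strongly protomodular if every change of base functor $g^*\colon\mathrm{Pt}_A(\mathcal C)\to\mathrm{Pt}_E(\mathcal C)$ (pullback along $g\colon E\to A$) is left exact, conservative and reflects normal monomorphisms. For objects $A$, $X$ let $A\flat X=\mathrm{Ker}([1,0]\colon A+X\to A)$; $A\flat(-)$ is the monad of the adjunction between $X\mapsto (A+X\rightleftarrows A)$ and $K_A$, and an internal $A$-action on $X$ is an algebra $\xi\colon A\flat X\to X$ for this monad. Theorem. The following statements are equivalent: (1) $\mathcal C$ is strongly protomodular; (2) for all objects $A$, $Y$, every internal $A$-action $\xi\colon A\flat Y\to Y$ and every normal monomorphism $f\colon X\to Y$: if $\xi$ restricts to $X$, i.e. there is an $A$-action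 $\xi_|\colon A\flat X\to X$ with $\xi\cdot(1\flat f)=f\cdot\xi_|$, then $\xi$ passes to the quotient $Y/X$, i.e. there are a short exact sequence $X\xrightarrow{f}Y\xrightarrow{g}Z=Y/X$ ($g$ a regular epimorphism, $f=\ker g$) and an $A$-action $\overline\xi\colon A\flat Z\to Z$ with $\overline\xi\cdot(1\flat g)=g\cdot\xi$. -/

import Mathlib

open CategoryTheory CategoryTheory.Limits

-- Only a priority: makes `X ⟶ Y` elaborate to the usual hom-sets of the category `C`.
attribute [local instance 2000] CategoryStruct.toQuiver

namespace InternalActions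

universe v u

section NormalMonomorphisms

variable {D : Type u} [Category.{v} D]

/-- A morphism `f : X ⟶ Y` is an equivalence class of the relation `r₁, r₂ : R ⟶ Y`
(in generalized elements: any two elements of `X` are `R`-related in `Y`, and any element of `Y`
that is `R`-related to an element of `X` lies in `X`): there is a morphism `t : X × X ⟶ R` over
`f × f`, and the square
```
 X × X --t--> R
   |p₁        |r₁
   v          v
   X ---f---> Y
```
is a pullback. -/
def IsEquivalenceClass {X Y R : D} (f : X ⟶ Y) (r₁ r₂ : R ⟶ Y) : Prop :=
  ∃ (P : D) (p₁ p₂ : P ⟶ X) (t : P ⟶ R),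
    Nonempty (IsLimit (BinaryFan.mk p₁ p₂)) ∧ IsPullback t p₁ r₁ f ∧ t ≫ r₂ = p₂ ≫ f

/-- A monomorphism is normal when it is an equivalence class of some internal equivalence
relation on its codomain. -/
def IsNormalMono {X Y : D} (f : X ⟶ Y) : Prop :=
  Mono f ∧ ∃ (R : D) (r₁ r₂ : R ⟶ Y), IsEquivalenceRelation r₁ r₂ ∧ IsEquivalenceClass f r₁ r₂

/-- A functor is normal when it is left exact, conservative and reflects normal monomorphisms. -/
structure IsNormalFunctor {D' : Type*} [Category* D'] (F : D ⥤ D') : Prop where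
  leftExact : PreservesFiniteLimits F
  conservative : F.ReflectsIsomorphisms
  reflects_normalMono : ∀ ⦃X Y : D⦄ (f : X ⟶ Y), IsNormalMono (F.map f) → IsNormalMono f

end NormalMonomorphisms

section Points

attribute [local simp] pullback.lift_fst pullback.lift_snd pullback.lift_fst_assoc
  pullback.lift_snd_assoc

variable {C : Type u} [Category.{v} C]

/-- A point over `A`: a split epimorphism with codomain `A`, together with a chosen section. -/
structure Pt (A : C) where
  /-- the domain of the split epimorphism -/
  dom : C
  /-- the split epimorphism -/
  proj : dom ⟶ A
  /-- its section -/
  sec : A ⟶ dom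
  sec_proj : sec ≫ proj = 𝟙 A

attribute [simp] Pt.sec_proj

namespace Pt

variable {A : C}

/-- A morphism of points over `A`: it commutes with the projections and with the sections. -/
@[ext]
structure Hom (P Q : Pt A) where
  /-- the underlying morphism -/
  hom : P.dom ⟶ Q.dom
  w_proj : hom ≫ Q.proj = P.proj
  w_sec : P.sec ≫ hom = Q.sec

/-- The fibre over `A` of the fibration of points. -/
instance : Category (Pt A) where
  Hom := Hom
  id P := ⟨𝟙 P.dom, by simp, by simp⟩
  comp f g := ⟨f.hom ≫ g.hom, by rw [Category.assoc, g.w_proj, f.w_proj],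
    by rw [← Category.assoc, f.w_sec, g.w_sec]⟩
  id_comp f := Hom.ext (Category.id_comp f.hom)
  comp_id f := Hom.ext (Category.comp_id f.hom)
  assoc f g h := Hom.ext (Category.assoc f.hom g.hom h.hom)

@[ext]
theorem hom_ext {P Q : Pt A} {f g : P ⟶ Q} (h : f.hom = g.hom) : f = g := Hom.ext h

@[simp]
theorem hom_proj {P Q : Pt A} (f : P ⟶ Q) : Hom.hom f ≫ Q.proj = P.proj := f.w_proj

@[simp]
theorem sec_hom {P Q : Pt A} (f : P ⟶ Q) : P.sec ≫ Hom.hom f = Q.sec := f.w_sec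

@[simp]
theorem id_hom (P : Pt A) : Hom.hom (𝟙 P) = 𝟙 P.dom := rfl

@[simp]
theorem comp_hom {P Q R : Pt A} (f : P ⟶ Q) (g : Q ⟶ R) : (f ≫ g).hom = f.hom ≫ g.hom := rfl

end Pt

/-- The pullback of a point over `A` along `g : E ⟶ A`. -/
noncomputable abbrev Pt.pullback [HasPullbacks C] {E A : C} (g : E ⟶ A) (P : Pt A) : Pt E where
  dom := Limits.pullback P.proj g
  proj := pullback.snd P.proj g
  sec := pullback.lift (g ≫ P.sec) (𝟙 E) (by simp)
  sec_proj := by simp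

/-- The change of base functor along `g : E ⟶ A`, given by pulling points back along `g`. -/
@[simps]
noncomputable def changeOfBase [HasPullbacks C] {E A : C} (g : E ⟶ A) : Pt A ⥤ Pt E where
  obj P := P.pullback g
  map {P Q} φ :=
    { hom := pullback.lift (f := Q.proj) (g := g) (pullback.fst P.proj g ≫ Pt.Hom.hom φ)
        (pullback.snd P.proj g) (by simp [pullback.condition])
      w_proj := by simp
      w_sec := by apply pullback.hom_ext <;> simp }
  map_id P := by ext <;> simp
  map_comp f g := by ext <;> simp

/-- A category with pullbacks is strongly protomodular when all the change of base functors of its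
fibration of points are normal. -/
def IsStronglyProtomodular (C : Type u) [Category.{v} C] [HasPullbacks C] : Prop :=
  ∀ ⦃E A : C⦄ (g : E ⟶ A), IsNormalFunctor (changeOfBase g)

end Points

section SemiAbelian

variable {C : Type u} [Category.{v} C] [HasZeroMorphisms C]

/-- The kernel functor `K_A` from points over `A` to the base category: the kernel of the projection. -/
@[simps]
noncomputable def kernelFunctor [HasKernels C] (A : C) : Pt A ⥤ C where
  obj P := kernel P.proj
  map {P Q} φ := kernel.lift Q.proj (kernel.ι P.proj ≫ Pt.Hom.hom φ) (by simp)
  map_id P := by apply equalizer.hom_ext; simp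
  map_comp f g := by apply equalizer.hom_ext; simp

/-- A pointed category with kernels is protomodular when all its kernel functors reflect
isomorphisms. -/
class IsProtomodular (C : Type u) [Category.{v} C] [HasZeroMorphisms C] [HasKernels C] :
    Prop where
  reflectsIsomorphisms : ∀ A : C, (kernelFunctor A).ReflectsIsomorphisms

/-- A regular category is Barr exact when every internal equivalence relation is effective, that
is, the kernel pair of some morphism. -/
class IsBarrExact (C : Type u) [Category.{v} C] : Prop extends Regular C where
  effective : ∀ ⦃R Y : C⦄ (r₁ r₂ : R ⟶ Y), IsEquivalenceRelation r₁ r₂ →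
    ∃ (Z : C) (g : Y ⟶ Z), IsKernelPair g r₁ r₂

/-- A semi-abelian category: pointed, Barr exact and protomodular, with finite coproducts. -/
class IsSemiAbelian (C : Type u) [Category.{v} C] [HasZeroMorphisms C] : Prop extends
    HasZeroObject C, IsBarrExact C, IsProtomodular C where
  hasFiniteCoproducts : HasFiniteCoproducts C

attribute [instance] IsSemiAbelian.hasFiniteCoproducts

/-- A short exact sequence `X ⟶ Y ⟶ Z`: `g` is a regular epimorphism and `f` is a kernel of
`g`. -/
def IsShortExact {X Y Z : C} (f : X ⟶ Y) (g : Y ⟶ Z) : Prop :=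
  IsRegularEpi g ∧ ∃ w : f ≫ g = 0, Nonempty (IsLimit (KernelFork.ofι f w))

end SemiAbelian

section Actions

attribute [local simp] coprod.inl_desc coprod.inr_desc coprod.inl_desc_assoc coprod.inr_desc_assoc

variable {C : Type u} [Category.{v} C] [HasZeroMorphisms C] [HasKernels C] [HasBinaryCoproducts C]

/-- The point `[1, 0] : A + X ⟶ A`, with section the coproduct injection. -/
noncomputable abbrev freePt (A X : C) : Pt A where
  dom := A ⨿ X
  proj := coprod.desc (𝟙 A) 0
  sec := coprod.inl
  sec_proj := by simp

/-- The functor sending `X` to the point `A + X ⟶ A`. -/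
@[simps]
noncomputable def freePtFunctor (A : C) : C ⥤ Pt A where
  obj X := freePt A X
  map {X Y} h :=
    { hom := coprod.map (𝟙 A) h
      w_proj := by simp
      w_sec := by simp }
  map_id X := by ext <;> simp
  map_comp f g := by ext <;> simp

/-- Morphisms of points `(A + X ⟶ A) ⟶ P` correspond to morphisms from `X` to the kernel of the
projection of `P`. -/
@[simps]
noncomputable def freePtHomEquiv (A X : C) (P : Pt A) :
    (freePt A X ⟶ P) ≃ (X ⟶ kernel P.proj) where
  toFun h := kernel.lift P.proj ((coprod.inr : X ⟶ A ⨿ X) ≫ Pt.Hom.hom h) (by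
    have := Pt.hom_proj h
    dsimp at this
    simp [this])
  invFun k :=
    { hom := coprod.desc P.sec (k ≫ kernel.ι P.proj)
      w_proj := by apply coprod.hom_ext <;> simp
      w_sec := by simp }
  left_inv h := by
    have := Pt.sec_hom h
    dsimp at this
    ext <;> simp [this]
  right_inv k := by ext; simp

theorem freePtHomEquiv_symm_comp {A X X' : C} {P : Pt A} (f : X' ⟶ X) (g : X ⟶ kernel P.proj) :
    (freePtHomEquiv A X' P).symm (f ≫ g) =
      (freePtFunctor A).map f ≫ (freePtHomEquiv A X P).symm g := by
  apply Pt.hom_ext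
  change coprod.desc P.sec ((f ≫ g) ≫ kernel.ι P.proj) =
    coprod.map (𝟙 A) f ≫ coprod.desc P.sec (g ≫ kernel.ι P.proj)
  simp

theorem freePtHomEquiv_comp {A X : C} {P Q : Pt A} (f : freePt A X ⟶ P) (g : P ⟶ Q) :
    freePtHomEquiv A X Q (f ≫ g) = freePtHomEquiv A X P f ≫ (kernelFunctor A).map g := by
  apply equalizer.hom_ext
  change _ = (freePtHomEquiv A X P f ≫
    kernel.lift Q.proj (kernel.ι P.proj ≫ Pt.Hom.hom g) (by simp)) ≫ kernel.ι Q.proj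
  rw [Category.assoc, kernel.lift_ι]
  simp

/-- The functor `X ↦ (A + X ⟶ A)` is left adjoint to the kernel functor. -/
noncomputable def freePtAdj (A : C) : freePtFunctor A ⊣ kernelFunctor A :=
  Adjunction.mkOfHomEquiv
    { homEquiv X P := freePtHomEquiv A X P
      homEquiv_naturality_left_symm f g := freePtHomEquiv_symm_comp f g
      homEquiv_naturality_right f g := freePtHomEquiv_comp f g }

/-- The monad `A ♭ (-)` on `C`, with `A ♭ X` the kernel of `[1, 0] : A + X ⟶ A`. -/
noncomputable def flat (A : C) : Monad C := (freePtAdj A).toMonad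

/-- An internal `A`-action on `X`: an algebra structure on `X` for the monad `A ♭ (-)`. -/
structure InternalAction (A X : C) where
  /-- the structure morphism `A ♭ X ⟶ X` -/
  act : (flat A).obj X ⟶ X
  unit : (flat A).η.app X ≫ act = 𝟙 X
  assoc : (flat A).μ.app X ≫ act = (flat A).map act ≫ act

/-- A morphism `h : X ⟶ Y` is equivariant for the given `A`-actions:
`ζ` followed by `h` is `1 ♭ h` followed by `ξ`. -/
def IsEquivariant {A X Y : C} (ζ : InternalAction A X) (ξ : InternalAction A Y) (h : X ⟶ Y) :
    Prop :=
  (flat A).map h ≫ ξ.act = ζ.act ≫ h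

/-- The action `ξ` on `Y` restricts along `f : X ⟶ Y`. -/
def InternalAction.Restricts {A X Y : C} (ξ : InternalAction A Y) (f : X ⟶ Y) : Prop :=
  ∃ ζ : InternalAction A X, IsEquivariant ζ ξ f

/-- The action `ξ` on `Y` passes to the quotient `Y / X`, for `f : X ⟶ Y`: there is a short exact
sequence `X ⟶ Y ⟶ Y / X` starting with `f`, and an action on `Y / X` for which the quotient map is
equivariant. -/
def InternalAction.PassesToQuotient {A X Y : C} (ξ : InternalAction A Y) (f : X ⟶ Y) : Prop :=
  ∃ (Z : C) (g : Y ⟶ Z), IsShortExact f g ∧ ∃ ζ : InternalAction A Z, IsEquivariant ξ ζ g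

end Actions

end InternalActions

open InternalActions

/-! Write `K` for the kernel functor on points over `A`. It has a left adjoint, is conservative by
protomodularity, and preserves coequalizers of reflexive pairs, hence is monadic
(`isEquivalence_comparison_freePtAdj`): actions are points, and equivariant morphisms are morphisms
of points. Preservation of coequalizers rests on exactness and on the Mal'tsev property
(`isEquivalenceRelation_of_reflexive`), which together make the image of a reflexive pair a kernel
pair.

Pulling a point back does not change its kernel, so change of base is conservative; it is also left
exact. Only reflection of normal monomorphisms remains, and, as the kernel functor over a zero
object is an equivalence, strong protomodularity says exactly that every `K` reflects them.

Condition (2) is the same statement read through monadicity. An equivariant normal `f` is some `K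
φ`. If `φ` is normal, the coequalizer of its relation is a point whose kernel carries the quotient
action (`IsNormalMono.exists_isShortExact`). Conversely, a quotient action is a point `Z'`, and `φ`
is the pullback of the zero point along a morphism to `Z'`, hence normal
(`Pt.isNormalMono_of_isShortExact`). -/

namespace InternalActions

attribute [local simp] pullback.lift_fst pullback.lift_snd pullback.lift_fst_assoc
  pullback.lift_snd_assoc prod.lift_fst prod.lift_snd prod.lift_fst_assoc prod.lift_snd_assoc
  coprod.inl_desc coprod.inr_desc coprod.inl_desc_assoc coprod.inr_desc_assoc

universe v u v' u'

/-! ### Normal monomorphisms under left exact functors and isomorphisms -/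

section NormalMonomorphisms

variable {D : Type u} [Category.{v} D] {D' : Type u'} [Category.{v'} D']

/-- Joint monicity is monicity of the pairing into the product, and a left exact functor preserves
both products and monomorphisms. -/
theorem jointlyMono₂_map [HasFiniteLimits D] (F : D ⥤ D') [PreservesFiniteLimits F] {R Y Y' : D}
    {r₁ : R ⟶ Y} {r₂ : R ⟶ Y'} (h : JointlyMono₂ r₁ r₂) :
    JointlyMono₂ (F.map r₁) (F.map r₂) where
  right_cancellation T a b h₁ h₂ := by
    have : Mono (prod.lift r₁ r₂) := ⟨fun a b hab => h.right_cancellation a b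
      (by simpa using hab =≫ prod.fst) (by simpa using hab =≫ prod.snd)⟩
    rw [← cancel_mono (F.map (prod.lift r₁ r₂))]
    refine BinaryFan.IsLimit.hom_ext
      (mapIsLimitOfPreservesOfIsLimit F _ _ (prodIsProd Y Y')) ?_ ?_
    · change (a ≫ F.map _) ≫ F.map _ = (b ≫ F.map _) ≫ F.map _
      rw [Category.assoc, Category.assoc, ← F.map_comp, prod.lift_fst, h₁]
    · change (a ≫ F.map _) ≫ F.map _ = (b ≫ F.map _) ≫ F.map _
      rw [Category.assoc, Category.assoc, ← F.map_comp, prod.lift_snd, h₂]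

theorem isEquivalenceRelation_map [HasFiniteLimits D] (F : D ⥤ D') [PreservesFiniteLimits F]
    {R Y : D} {r₁ r₂ : R ⟶ Y} (h : IsEquivalenceRelation r₁ r₂) :
    IsEquivalenceRelation (F.map r₁) (F.map r₂) := by
  obtain ⟨⟨e⟩⟩ := h
  have := jointlyMono₂_map F e.toJointlyMono₂
  exact ⟨⟨{ e.toReflexiveRelation.map F, e.toSymmetricRelation.map F,
    e.toTransitiveRelation.map F with }⟩⟩

theorem IsEquivalenceClass.map [HasFiniteLimits D] (F : D ⥤ D') [PreservesFiniteLimits F]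
    {X Y R : D} {f : X ⟶ Y} {r₁ r₂ : R ⟶ Y} (h : IsEquivalenceClass f r₁ r₂) :
    IsEquivalenceClass (F.map f) (F.map r₁) (F.map r₂) := by
  obtain ⟨P, p₁, p₂, t, ⟨hP⟩, hpb, ht⟩ := h
  exact ⟨F.obj P, F.map p₁, F.map p₂, F.map t, ⟨mapIsLimitOfPreservesOfIsLimit F _ _ hP⟩,
    hpb.map F, by rw [← F.map_comp, ht, F.map_comp]⟩

/-- Left exact functors preserve normal monomorphisms. -/
theorem IsNormalMono.map [HasFiniteLimits D] (F : D ⥤ D') [PreservesFiniteLimits F]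
    {X Y : D} {f : X ⟶ Y} (h : IsNormalMono f) : IsNormalMono (F.map f) := by
  obtain ⟨_, R, r₁, r₂, hR, hf⟩ := h
  exact ⟨inferInstance, F.obj R, F.map r₁, F.map r₂, isEquivalenceRelation_map F hR, hf.map F⟩

theorem isEquivalenceRelation_comp_iso {R Y Y' : D} {r₁ r₂ : R ⟶ Y}
    (h : IsEquivalenceRelation r₁ r₂) (j : Y ≅ Y') :
    IsEquivalenceRelation (r₁ ≫ j.hom) (r₂ ≫ j.hom) := by
  obtain ⟨⟨e⟩⟩ := h
  have hpb : IsPullback e.c.fst e.c.snd (r₂ ≫ j.hom) (r₁ ≫ j.hom) :=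
    (IsPullback.of_isLimit e.isLimit).of_iso (Iso.refl _) (Iso.refl _) (Iso.refl _) j
      (by simp) (by simp) (by simp) (by simp)
  exact ⟨⟨{
    right_cancellation := fun _ a b h₁ h₂ => e.right_cancellation a b
      (by simpa [← Category.assoc] using h₁) (by simpa [← Category.assoc] using h₂)
    r := j.inv ≫ e.r
    reflexivity₁ := by simp [reassoc_of% e.reflexivity₁]
    reflexivity₂ := by simp [reassoc_of% e.reflexivity₂]
    s := e.s
    symmetry₁ := by rw [← Category.assoc, e.symmetry₁]
    symmetry₂ := by rw [← Category.assoc, e.symmetry₂]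
    c := hpb.cone
    isLimit := hpb.isLimit
    t := e.t
    transitivity₁ := by
      change e.t ≫ r₁ ≫ j.hom = e.c.fst ≫ r₁ ≫ j.hom
      rw [reassoc_of% e.transitivity₁]
    transitivity₂ := by
      change e.t ≫ r₂ ≫ j.hom = e.c.snd ≫ r₂ ≫ j.hom
      rw [reassoc_of% e.transitivity₂] }⟩⟩

theorem IsNormalMono.of_iso {X Y X' Y' : D} {f : X ⟶ Y} {f' : X' ⟶ Y'} (h : IsNormalMono f)
    (i : X ≅ X') (j : Y ≅ Y') (w : f ≫ j.hom = i.hom ≫ f') : IsNormalMono f' := by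
  obtain ⟨_, R, r₁, r₂, hR, P, p₁, p₂, t, ⟨hP⟩, hpb, ht⟩ := h
  have hf' : f' = i.inv ≫ f ≫ j.hom := by simp [w]
  refine ⟨by rw [hf']; infer_instance, R, _, _, isEquivalenceRelation_comp_iso hR j,
    P, p₁ ≫ i.hom, p₂ ≫ i.hom, t, ⟨?_⟩, ?_, ?_⟩
  · let L {T : D} (a b : T ⟶ X') : T ⟶ P := BinaryFan.IsLimit.lift hP (a ≫ i.inv) (b ≫ i.inv)
    have h₁ {T : D} (a b : T ⟶ X') : L a b ≫ p₁ = a ≫ i.inv := BinaryFan.IsLimit.lift_fst hP _ _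
    have h₂ {T : D} (a b : T ⟶ X') : L a b ≫ p₂ = b ≫ i.inv := BinaryFan.IsLimit.lift_snd hP _ _
    refine BinaryFan.IsLimit.mk _ (fun a b => L a b) (fun a b => ?_) (fun a b => ?_)
      (fun a b m hm₁ hm₂ => ?_)
    · change L a b ≫ p₁ ≫ i.hom = a
      rw [reassoc_of% h₁ a b, i.inv_hom_id, Category.comp_id]
    · change L a b ≫ p₂ ≫ i.hom = b
      rw [reassoc_of% h₂ a b, i.inv_hom_id, Category.comp_id]
    · refine BinaryFan.IsLimit.hom_ext hP (Eq.trans ?_ (h₁ a b).symm) (Eq.trans ?_ (h₂ a b).symm)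
      · rw [← hm₁]
        change m ≫ p₁ = (m ≫ p₁ ≫ i.hom) ≫ i.inv
        simp
      · rw [← hm₂]
        change m ≫ p₂ = (m ≫ p₂ ≫ i.hom) ≫ i.inv
        simp
  · exact hpb.of_iso (Iso.refl _) (Iso.refl _) i j (by simp) (by simp) (by simp) (by simpa using w)
  · simp [reassoc_of% ht, w]

/-- An equivalence of categories reflects normal monomorphisms. -/
theorem IsNormalMono.of_map_of_isEquivalence [HasFiniteLimits D'] (F : D ⥤ D') [F.IsEquivalence]
    {X Y : D} {f : X ⟶ Y} (h : IsNormalMono (F.map f)) : IsNormalMono f :=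
  (h.map F.inv).of_iso (F.asEquivalence.unitIso.app X).symm (F.asEquivalence.unitIso.app Y).symm
    (F.asEquivalence.unitIso.inv.naturality f)

/-- The pullback of a morphism with domain a zero object is a normal monomorphism. -/
theorem IsNormalMono.of_isPullback_of_isZero [HasFiniteLimits D] {X Y Z O : D} {f : X ⟶ Y}
    {a : X ⟶ O} {g : Y ⟶ Z} {b : O ⟶ Z} (hO : IsZero O) (h : IsPullback f a g b) :
    IsNormalMono f := by
  have : Mono f := ⟨fun x y hxy => h.hom_ext hxy (hO.eq_of_tgt _ _)⟩
  let r₁ := pullback.fst g g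
  let r₂ := pullback.snd g g
  have hR : IsKernelPair g r₁ r₂ := IsKernelPair.of_hasPullback g
  refine ⟨this, _, r₁, r₂, (hR.equivalenceRelation g r₁ r₂ (pullbackIsPullback r₂ r₁)).isEquivalenceRelation,
    X ⨯ X, prod.fst, prod.snd, hR.lift (prod.fst ≫ f) (prod.snd ≫ f) ?_, ⟨prodIsProd X X⟩, ?_, ?_⟩
  · rw [Category.assoc, Category.assoc, h.w, reassoc_of% hO.eq_of_tgt (prod.fst ≫ a) (prod.snd ≫ a)]
  -- An element related to one of `X` has the same image under `g`, which factors through `O`; so it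
  -- lies in `X`.
  · refine ⟨⟨by simp⟩, ⟨PullbackCone.IsLimit.mk _
      (fun s => prod.lift s.snd (h.lift (s.fst ≫ r₂) (s.snd ≫ a) ?_)) ?_ ?_ ?_⟩⟩
    · rw [Category.assoc, ← hR.w, reassoc_of% s.condition, h.w, Category.assoc]
    · intro s
      apply hR.hom_ext
      · simp only [Category.assoc, hR.lift_fst, prod.lift_fst_assoc, s.condition]
      · simp only [Category.assoc, hR.lift_snd, prod.lift_snd_assoc, h.lift_fst]
    · intro s
      exact prod.lift_fst _ _
    · intro s m h₁ h₂
      apply Limits.prod.hom_ext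
      · rw [h₂, prod.lift_fst]
      · rw [← cancel_mono f, prod.lift_snd, h.lift_fst, ← h₁, Category.assoc, Category.assoc,
          hR.lift_snd]
  · simp

/-- An equivalence class of the kernel pair of `g` is a kernel of `g`. -/
theorem IsEquivalenceClass.isLimit_kernelFork [HasZeroMorphisms D] {X Y Z R : D} {f : X ⟶ Y}
    [Mono f] {r₁ r₂ : R ⟶ Y} {g : Y ⟶ Z} (h : IsEquivalenceClass f r₁ r₂)
    (hR : IsKernelPair g r₁ r₂) :
    ∃ w : f ≫ g = 0, Nonempty (IsLimit (KernelFork.ofι f w)) := by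
  obtain ⟨P, p₁, p₂, t, ⟨hP⟩, hpb, ht⟩ := h
  have w : f ≫ g = 0 := by
    -- The pair `(1, 0)`: every element of `X` is related to `0`.
    let x := BinaryFan.IsLimit.lift hP (𝟙 X) 0
    have h₁ : x ≫ p₁ = 𝟙 X := BinaryFan.IsLimit.lift_fst hP (𝟙 X) 0
    have h₂ : x ≫ p₂ = 0 := BinaryFan.IsLimit.lift_snd hP (𝟙 X) 0
    calc f ≫ g = x ≫ p₁ ≫ f ≫ g := by rw [reassoc_of% h₁]
      _ = x ≫ t ≫ r₁ ≫ g := by rw [← reassoc_of% hpb.w]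
      _ = x ≫ p₂ ≫ f ≫ g := by rw [hR.w, reassoc_of% ht]
      _ = 0 := by rw [reassoc_of% h₂, zero_comp]
  have key : ∀ {W : D} (k : W ⟶ Y) (hk : k ≫ g = 0), ∃ l : W ⟶ X, l ≫ f = k := by
    intro W k hk
    have h₀ : (0 : W ⟶ Y) ≫ g = k ≫ g := by rw [hk, zero_comp]
    -- Since `k ≫ g = 0`, the pair `(0, k)` is in `R`; as `0` lies in the class `X`, so does `k`.
    refine ⟨hpb.lift (hR.lift 0 k h₀) 0 (by simp) ≫ p₂, ?_⟩
    rw [Category.assoc, ← ht, hpb.lift_fst_assoc, hR.lift_snd]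
  choose l hl using @key
  exact ⟨w, ⟨KernelFork.IsLimit.ofι _ _ (fun k hk => l k hk) (fun k hk => hl k hk)
    (fun k hk m hm => by rw [← cancel_mono f, hm, hl])⟩⟩

end NormalMonomorphisms

/-! ### Limits of points -/

section LimitsOfPoints

variable {C : Type u} [Category.{v} C] {A : C}

theorem Pt.isIso_hom {P Q : Pt A} (φ : P ⟶ Q) [IsIso φ] : IsIso φ.hom :=
  ⟨(inv φ).hom, by rw [← Pt.comp_hom, IsIso.hom_inv_id, Pt.id_hom],
    by rw [← Pt.comp_hom, IsIso.inv_hom_id, Pt.id_hom]⟩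

/-- The zero object of the category of points over `A`. -/
def Pt.zero (A : C) : Pt A where
  dom := A
  proj := 𝟙 A
  sec := 𝟙 A
  sec_proj := Category.comp_id _

theorem Pt.isZero_zero (A : C) : IsZero (Pt.zero A) where
  unique_to Q := ⟨⟨⟨⟨Q.sec, Q.sec_proj, Category.id_comp _⟩⟩, fun φ => by
    apply Pt.hom_ext
    simpa [Pt.zero] using Pt.sec_hom φ⟩⟩
  unique_from Q := ⟨⟨⟨⟨Q.proj, Category.comp_id _, Q.sec_proj⟩⟩, fun φ => by
    apply Pt.hom_ext
    simpa [Pt.zero] using Pt.hom_proj φ⟩⟩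

/-- Squares of points that are pullbacks of the underlying objects are pullbacks. -/
theorem Pt.isPullback_of_hom {W X Y Z : Pt A} {f : W ⟶ X} {g : W ⟶ Y} {h : X ⟶ Z} {k : Y ⟶ Z}
    (H : IsPullback f.hom g.hom h.hom k.hom) : IsPullback f g h k := by
  refine ⟨⟨Pt.hom_ext H.w⟩, ⟨PullbackCone.IsLimit.mk _
    (fun s => ⟨H.lift s.fst.hom s.snd.hom (congrArg Pt.Hom.hom s.condition), ?_, ?_⟩) ?_ ?_ ?_⟩⟩
  · rw [← Pt.hom_proj f, H.lift_fst_assoc, Pt.hom_proj]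
  · apply H.hom_ext
    · rw [Category.assoc, H.lift_fst, Pt.sec_hom, Pt.sec_hom]
    · rw [Category.assoc, H.lift_snd, Pt.sec_hom, Pt.sec_hom]
  · intro s
    exact Pt.hom_ext (H.lift_fst _ _ _)
  · intro s
    exact Pt.hom_ext (H.lift_snd _ _ _)
  · intro s m h₁ h₂
    apply Pt.hom_ext
    apply H.hom_ext
    · rw [H.lift_fst, ← h₁, Pt.comp_hom]
    · rw [H.lift_snd, ← h₂, Pt.comp_hom]

theorem Pt.hasLimit_cospan [HasPullbacks C] {X Y Z : Pt A} (h : X ⟶ Z) (k : Y ⟶ Z) :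
    HasPullback h k := by
  let W : Pt A :=
    { dom := Limits.pullback h.hom k.hom
      proj := pullback.fst h.hom k.hom ≫ X.proj
      sec := pullback.lift X.sec Y.sec (by rw [Pt.sec_hom, Pt.sec_hom])
      sec_proj := by simp }
  let f : W ⟶ X := ⟨pullback.fst h.hom k.hom, rfl, pullback.lift_fst _ _ _⟩
  let g : W ⟶ Y := ⟨pullback.snd h.hom k.hom, by
    rw [← Pt.hom_proj k, ← pullback.condition_assoc, Pt.hom_proj], pullback.lift_snd _ _ _⟩
  exact (Pt.isPullback_of_hom (f := f) (g := g) (IsPullback.of_hasPullback h.hom k.hom)).hasPullback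

instance Pt.hasFiniteLimits [HasPullbacks C] : HasFiniteLimits (Pt A) := by
  have : HasPullbacks (Pt A) :=
    @hasPullbacks_of_hasLimit_cospan (Pt A) _ (Pt.hasLimit_cospan _ _)
  have : HasTerminal (Pt A) := (Pt.isZero_zero A).isTerminal.hasTerminal
  exact hasFiniteLimits_of_hasTerminal_and_pullbacks

/-- The projections of a limit of points are jointly universal among all objects over `A`. -/
theorem Pt.existsUnique_lift [HasBinaryCoproducts C] {J : Type*} [Category* J] {F : J ⥤ Pt A}
    {c : Cone F} (hc : IsLimit c) {T : C} (t : T ⟶ A) (u : ∀ j, T ⟶ (F.obj j).dom)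
    (hu : ∀ j, u j ≫ (F.obj j).proj = t) (hn : ∀ {i j} (α : i ⟶ j), u i ≫ (F.map α).hom = u j) :
    ∃! w : T ⟶ c.pt.dom, w ≫ c.pt.proj = t ∧ ∀ j, w ≫ (c.π.app j).hom = u j := by
  -- `T` is over `A` but has no section; `A ⨿ T` is the point it freely generates, so the universal
  -- property among points applies to it.
  let W : Pt A :=
    { dom := A ⨿ T
      proj := coprod.desc (𝟙 A) t
      sec := coprod.inl
      sec_proj := coprod.inl_desc _ _ }
  let ext (P : Pt A) (w : T ⟶ P.dom) (hw : w ≫ P.proj = t) : W ⟶ P :=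
    { hom := coprod.desc P.sec w
      w_proj := by apply coprod.hom_ext <;> simp [W, hw]
      w_sec := coprod.inl_desc _ _ }
  have ext_comp {P Q : Pt A} (w : T ⟶ P.dom) (hw) (φ : P ⟶ Q) (w' : T ⟶ Q.dom) (hw')
      (h : w ≫ φ.hom = w') : ext P w hw ≫ φ = ext Q w' hw' := by
    apply Pt.hom_ext
    apply coprod.hom_ext <;> simp [ext, h]
  let s : Cone F :=
    { pt := W
      π :=
        { app j := ext _ (u j) (hu j)
          naturality i j α := by
            dsimp
            rw [Category.id_comp]
            exact (ext_comp _ (hu i) _ _ (hu j) (hn α)).symm } }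
  refine ⟨coprod.inr ≫ (hc.lift s).hom, ⟨?_, fun j => ?_⟩, ?_⟩
  · rw [Category.assoc, Pt.hom_proj]
    exact coprod.inr_desc _ _
  · rw [Category.assoc, ← Pt.comp_hom, hc.fac]
    exact coprod.inr_desc _ _
  · rintro w ⟨hw, hw'⟩
    have : ext c.pt w hw = hc.lift s :=
      hc.uniq s _ (fun j => ext_comp _ hw _ _ (hu j) (hw' j))
    rw [← this]
    exact (coprod.inr_desc _ _).symm

end LimitsOfPoints

/-! ### Left exactness of change of base -/

section ChangeOfBase

variable {C : Type u} [Category.{v} C] [HasPullbacks C] {A E : C} (g : E ⟶ A)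

/-- The projection from the domain of the pullback of a point to the domain of the point. -/
noncomputable def changeOfBaseFst (P : Pt A) : ((changeOfBase g).obj P).dom ⟶ P.dom :=
  pullback.fst P.proj g

theorem changeOfBaseFst_proj (P : Pt A) :
    changeOfBaseFst g P ≫ P.proj = ((changeOfBase g).obj P).proj ≫ g :=
  pullback.condition

theorem sec_changeOfBaseFst (P : Pt A) :
    ((changeOfBase g).obj P).sec ≫ changeOfBaseFst g P = g ≫ P.sec :=
  pullback.lift_fst _ _ _

theorem changeOfBase_map_hom_fst {P Q : Pt A} (φ : P ⟶ Q) :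
    ((changeOfBase g).map φ).hom ≫ changeOfBaseFst g Q = changeOfBaseFst g P ≫ φ.hom :=
  pullback.lift_fst _ _ _

theorem changeOfBase_hom_ext {P : Pt A} {T : C} {a b : T ⟶ ((changeOfBase g).obj P).dom}
    (h₁ : a ≫ changeOfBaseFst g P = b ≫ changeOfBaseFst g P)
    (h₂ : a ≫ ((changeOfBase g).obj P).proj = b ≫ ((changeOfBase g).obj P).proj) : a = b :=
  pullback.hom_ext h₁ h₂

theorem changeOfBase_exists_lift {P : Pt A} {T : C} (a : T ⟶ P.dom) (b : T ⟶ E)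
    (h : a ≫ P.proj = b ≫ g) : ∃ l : T ⟶ ((changeOfBase g).obj P).dom,
      l ≫ changeOfBaseFst g P = a ∧ l ≫ ((changeOfBase g).obj P).proj = b :=
  ⟨pullback.lift a b h, pullback.lift_fst _ _ _, pullback.lift_snd _ _ _⟩

variable [HasBinaryCoproducts C]

theorem changeOfBase_existsUnique_lift {J : Type*} [Category* J] {F : J ⥤ Pt A}
    {c : Cone F} (hc : IsLimit c) (T : Pt E) (σ : ∀ j, T ⟶ (changeOfBase g).obj (F.obj j))
    (hσ : ∀ {i j} (α : i ⟶ j), σ i ≫ (changeOfBase g).map (F.map α) = σ j) :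
    ∃! w : T ⟶ (changeOfBase g).obj c.pt, ∀ j, w ≫ (changeOfBase g).map (c.π.app j) = σ j := by
  obtain ⟨w, ⟨hw, hwσ⟩, hw'⟩ := Pt.existsUnique_lift hc (T.proj ≫ g)
    (fun j => (σ j).hom ≫ changeOfBaseFst g (F.obj j))
    (fun j => by rw [Category.assoc, changeOfBaseFst_proj, ← Category.assoc, Pt.hom_proj])
    (fun {i j} α => by
      rw [← hσ α, Category.assoc, Pt.comp_hom, Category.assoc, changeOfBase_map_hom_fst])
  -- Compatibility with sections comes from uniqueness: both sides lift the same cone with vertex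
  -- `E`.
  have sec_w : T.sec ≫ w = g ≫ c.pt.sec := by
    refine (Pt.existsUnique_lift hc g (fun j => g ≫ (F.obj j).sec) (by simp) (by simp)).unique
      ⟨?_, fun j => ?_⟩ ⟨by simp, by simp⟩
    · rw [Category.assoc, hw, ← Category.assoc, Pt.sec_proj, Category.id_comp]
    · rw [Category.assoc, hwσ, ← Category.assoc, Pt.sec_hom, sec_changeOfBaseFst]
  obtain ⟨l, hl, hlp⟩ := changeOfBase_exists_lift g w T.proj hw
  refine ⟨⟨l, hlp, ?_⟩, fun j => ?_, fun m hm => ?_⟩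
  · apply changeOfBase_hom_ext g
    · rw [Category.assoc, hl, sec_w, sec_changeOfBaseFst]
    · rw [Category.assoc, hlp, Pt.sec_proj, Pt.sec_proj]
  · apply Pt.hom_ext
    apply changeOfBase_hom_ext g
    · rw [Pt.comp_hom, Category.assoc, changeOfBase_map_hom_fst, reassoc_of% hl, hwσ]
    · rw [Pt.hom_proj, Pt.hom_proj]
  · apply Pt.hom_ext
    apply changeOfBase_hom_ext g
    · refine Eq.trans (hw' _ ⟨?_, fun j => ?_⟩) hl.symm
      · rw [Category.assoc, changeOfBaseFst_proj, ← Category.assoc, Pt.hom_proj]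
      · rw [← hm j, Category.assoc, ← changeOfBase_map_hom_fst, Pt.comp_hom, Category.assoc]
    · rw [Pt.hom_proj, hlp]

instance preservesFiniteLimits_changeOfBase : PreservesFiniteLimits (changeOfBase g) where
  preservesFiniteLimits _ _ _ :=
    ⟨fun {_} => ⟨fun {_} hc => ⟨IsLimit.ofExistsUnique fun s =>
      changeOfBase_existsUnique_lift g hc s.pt s.π.app s.w⟩⟩⟩

end ChangeOfBase

/-! ### Kernels of points and their invariance under pullback -/

section KernelFunctor

variable {C : Type u} [Category.{v} C] [HasZeroMorphisms C] [HasKernels C] {A : C}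

/-- The inclusion of the kernel of a point into its domain. -/
noncomputable def kernelFunctorι (P : Pt A) : (kernelFunctor A).obj P ⟶ P.dom :=
  kernel.ι P.proj

instance (P : Pt A) : Mono (kernelFunctorι P) :=
  inferInstanceAs (Mono (kernel.ι P.proj))

theorem kernelFunctorι_proj (P : Pt A) : kernelFunctorι P ≫ P.proj = 0 :=
  kernel.condition P.proj

theorem kernelFunctor_map_ι {P Q : Pt A} (φ : P ⟶ Q) :
    (kernelFunctor A).map φ ≫ kernelFunctorι Q = kernelFunctorι P ≫ φ.hom :=
  kernel.lift_ι _ _ _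

theorem kernelFunctor_exists_lift {P : Pt A} {T : C} (k : T ⟶ P.dom) (h : k ≫ P.proj = 0) :
    ∃ l : T ⟶ (kernelFunctor A).obj P, l ≫ kernelFunctorι P = k :=
  ⟨kernel.lift P.proj k h, kernel.lift_ι _ _ _⟩

/-- The projection of `P` factors through that of `Q`, so its kernel is the inverse image of the
kernel of `Q`. Stability of regular epimorphisms thus passes from `φ` to its restriction to kernels.
-/
theorem isPullback_kernelFunctor_map {P Q : Pt A} (φ : P ⟶ Q) :
    IsPullback (kernelFunctorι P) ((kernelFunctor A).map φ) φ.hom (kernelFunctorι Q) := by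
  have key {T : C} (a : T ⟶ P.dom) (b : T ⟶ (kernelFunctor A).obj Q)
      (h : a ≫ φ.hom = b ≫ kernelFunctorι Q) :
      ∃ l : T ⟶ (kernelFunctor A).obj P, l ≫ kernelFunctorι P = a :=
    kernelFunctor_exists_lift a
      (by rw [← Pt.hom_proj φ, reassoc_of% h, kernelFunctorι_proj, comp_zero])
  choose l hl using @key
  refine ⟨⟨(kernelFunctor_map_ι φ).symm⟩, ⟨PullbackCone.IsLimit.mk _
    (fun s => l s.fst s.snd s.condition) (fun s => hl _ _ _) (fun s => ?_) (fun s m h₁ h₂ => ?_)⟩⟩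
  · rw [← cancel_mono (kernelFunctorι Q), Category.assoc, kernelFunctor_map_ι, reassoc_of% hl,
      s.condition]
  · rw [← cancel_mono (kernelFunctorι P), h₁, hl]

/-- Pulling back along `g : E ⟶ A` does not change the kernel of a point. -/
theorem nonempty_changeOfBase_comp_kernelFunctor_iso [HasPullbacks C] {E : C} (g : E ⟶ A) :
    Nonempty (changeOfBase g ⋙ kernelFunctor E ≅ kernelFunctor A) := by
  have h₁ (P : Pt A) : ∃ a : (kernelFunctor E).obj ((changeOfBase g).obj P) ⟶
      (kernelFunctor A).obj P, a ≫ kernelFunctorι P = kernelFunctorι _ ≫ changeOfBaseFst g P :=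
    kernelFunctor_exists_lift _ (by
      rw [Category.assoc, changeOfBaseFst_proj, ← Category.assoc, kernelFunctorι_proj, zero_comp])
  have h₂ (P : Pt A) : ∃ b : (kernelFunctor A).obj P ⟶
      (kernelFunctor E).obj ((changeOfBase g).obj P),
      b ≫ kernelFunctorι _ ≫ changeOfBaseFst g P = kernelFunctorι P := by
    obtain ⟨l, hl, hl'⟩ := changeOfBase_exists_lift g (kernelFunctorι P) 0
      (by rw [kernelFunctorι_proj, zero_comp])
    obtain ⟨b, hb⟩ := kernelFunctor_exists_lift l hl'
    exact ⟨b, by rw [reassoc_of% hb, hl]⟩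
  choose a ha using h₁
  choose b hb using h₂
  refine ⟨NatIso.ofComponents (fun P => ⟨a P, b P, ?_, ?_⟩) (fun {P Q} φ => ?_)⟩
  · change a P ≫ b P = 𝟙 _
    rw [← cancel_mono (kernelFunctorι _)]
    apply changeOfBase_hom_ext g
    · rw [Category.assoc, Category.assoc, Category.assoc, hb, ha, Category.id_comp]
    · rw [Category.assoc, Category.assoc, Category.assoc, kernelFunctorι_proj]
      simp
  · rw [← cancel_mono (kernelFunctorι _), Category.assoc, ha, hb, Category.id_comp]
  · change (kernelFunctor E).map ((changeOfBase g).map φ) ≫ a Q = a P ≫ (kernelFunctor A).map φ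
    rw [← cancel_mono (kernelFunctorι _), Category.assoc, ha, ← Category.assoc,
      kernelFunctor_map_ι, Category.assoc, changeOfBase_map_hom_fst, Category.assoc,
      kernelFunctor_map_ι, reassoc_of% ha]

/-- Points over a zero object are the same as objects. -/
theorem isEquivalence_kernelFunctor_of_isZero (hA : IsZero A) :
    (kernelFunctor A).IsEquivalence := by
  have hι (P : Pt A) : IsIso (kernelFunctorι P) := by
    obtain ⟨l, hl⟩ := kernelFunctor_exists_lift (𝟙 P.dom) (hA.eq_of_tgt _ _)
    exact ⟨l, by rw [← cancel_mono (kernelFunctorι P), Category.assoc, hl]; simp, hl⟩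
  refine { faithful := ⟨fun {P Q φ ψ} h => ?_⟩, full := ⟨fun {P Q} k => ?_⟩,
           essSurj := ⟨fun X => ?_⟩ }
  · apply Pt.hom_ext
    rw [← cancel_epi (kernelFunctorι P), ← kernelFunctor_map_ι, h, kernelFunctor_map_ι]
  · refine ⟨⟨inv (kernelFunctorι P) ≫ k ≫ kernelFunctorι Q, hA.eq_of_tgt _ _,
      hA.eq_of_src _ _⟩, ?_⟩
    rw [← cancel_mono (kernelFunctorι Q), kernelFunctor_map_ι]
    simp
  · let P : Pt A := ⟨X, 0, 0, hA.eq_of_src _ _⟩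
    exact ⟨P, ⟨asIso (kernelFunctorι P)⟩⟩

end KernelFunctor

/-! ### Protomodular categories are Mal'tsev -/

section Malcev

variable {C : Type u} [Category.{v} C] [HasZeroMorphisms C] [HasFiniteLimits C] [IsProtomodular C]

instance (A : C) : (kernelFunctor A).ReflectsIsomorphisms :=
  IsProtomodular.reflectsIsomorphisms A

/-- In a protomodular category, a subobject of the domain of a point that contains the section and
the kernel is everything. -/
theorem Pt.isIso_of_mono {A : C} (P : Pt A) {M : C} (m : M ⟶ P.dom) [Mono m] (s : A ⟶ M)
    (hs : s ≫ m = P.sec) (k : (kernelFunctor A).obj P ⟶ M) (hk : k ≫ m = kernelFunctorι P) :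
    IsIso m := by
  let Q : Pt A := ⟨M, m ≫ P.proj, s, by rw [reassoc_of% hs, P.sec_proj]⟩
  let φ : Q ⟶ P := ⟨m, rfl, hs⟩
  have h := isPullback_kernelFunctor_map φ
  have : IsIso ((kernelFunctor A).map φ) := by
    have hm : k ≫ φ.hom = 𝟙 _ ≫ kernelFunctorι P := by rw [Category.id_comp]; exact hk
    refine ⟨h.lift k (𝟙 _) hm, ?_, h.lift_snd _ _ hm⟩
    apply h.hom_ext
    · have hl : h.lift k (𝟙 _) hm ≫ kernelFunctorι Q = k := h.lift_fst _ _ hm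
      have hφ : (kernelFunctor A).map φ ≫ kernelFunctorι P = kernelFunctorι Q ≫ m :=
        kernelFunctor_map_ι φ
      rw [Category.assoc, hl, Category.id_comp]
      refine (cancel_mono m).1 ?_
      rw [Category.assoc, hk, hφ]
    · rw [Category.assoc, h.lift_snd, Category.comp_id, Category.id_comp]
  have : IsIso φ := isIso_of_reflects_iso φ (kernelFunctor A)
  exact Pt.isIso_hom φ

/-- A protomodular category is a Mal'tsev category: reflexive relations are equivalence
relations. -/
theorem isEquivalenceRelation_of_reflexive {R Y : C} {r₁ r₂ : R ⟶ Y} (h : JointlyMono₂ r₁ r₂)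
    (s : Y ⟶ R) (hs₁ : s ≫ r₁ = 𝟙 Y) (hs₂ : s ≫ r₂ = 𝟙 Y) : IsEquivalenceRelation r₁ r₂ := by
  have : Mono (prod.lift r₁ r₂) := ⟨fun a b hab => h.right_cancellation a b
    (by simpa using hab =≫ prod.fst) (by simpa using hab =≫ prod.snd)⟩
  -- `P` consists of pairs `(x R y, x R z)`, and `d` sends such a pair to `(y, z)`. The subobject
  -- where `y R z` contains the section (there `y = z`) and the kernel of `p₁` (there `x = y = 0`),
  -- hence is everything: `R` is Euclidean.
  let p₁ := pullback.fst r₁ r₁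
  let p₂ := pullback.snd r₁ r₁
  have hp : p₁ ≫ r₁ = p₂ ≫ r₁ := pullback.condition
  let P : Pt R := ⟨pullback r₁ r₁, p₁, pullback.lift (𝟙 R) (𝟙 R) rfl, pullback.lift_fst _ _ _⟩
  let d : P.dom ⟶ Y ⨯ Y := prod.lift (p₁ ≫ r₂) (p₂ ≫ r₂)
  have hP₁ : P.sec ≫ p₁ = 𝟙 R := pullback.lift_fst _ _ _
  have hP₂ : P.sec ≫ p₂ = 𝟙 R := pullback.lift_snd _ _ _
  have hκ : kernelFunctorι P ≫ p₁ = 0 := kernelFunctorι_proj P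
  have hsec : P.sec ≫ d = (r₂ ≫ s) ≫ prod.lift r₁ r₂ := by
    apply Limits.prod.hom_ext
    · simp [d, reassoc_of% hP₁, hs₁]
    · simp [d, reassoc_of% hP₂, hs₂]
  have hker : kernelFunctorι P ≫ d = (kernelFunctorι P ≫ p₂) ≫ prod.lift r₁ r₂ := by
    apply Limits.prod.hom_ext
    · simp [d, ← hp, reassoc_of% hκ]
    · simp [d]
  have hiso : IsIso (pullback.fst d (prod.lift r₁ r₂)) :=
    P.isIso_of_mono _ (pullback.lift _ _ hsec) (pullback.lift_fst _ _ _)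
      (pullback.lift _ _ hker) (pullback.lift_fst _ _ _)
  have euclid {T : C} (a b : T ⟶ R) (hab : a ≫ r₁ = b ≫ r₁) :
      ∃ c : T ⟶ R, c ≫ r₁ = a ≫ r₂ ∧ c ≫ r₂ = b ≫ r₂ := by
    let e := inv (pullback.fst d (prod.lift r₁ r₂)) ≫ pullback.snd d (prod.lift r₁ r₂)
    have he : e ≫ prod.lift r₁ r₂ = d := by
      rw [Category.assoc, ← pullback.condition, IsIso.inv_hom_id_assoc]
    have he₁ : e ≫ r₁ = p₁ ≫ r₂ := by simpa [d] using he =≫ prod.fst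
    have he₂ : e ≫ r₂ = p₂ ≫ r₂ := by simpa [d] using he =≫ prod.snd
    refine ⟨pullback.lift a b hab ≫ e, ?_, ?_⟩
    · rw [Category.assoc, he₁, pullback.lift_fst_assoc]
    · rw [Category.assoc, he₂, pullback.lift_snd_assoc]
  -- Symmetry: `x R y` and `x R x` give `y R x`. Transitivity then follows from `y R x` and `y R z`.
  obtain ⟨σ, hσ₁, hσ₂⟩ := euclid (𝟙 R) (r₁ ≫ s) (by simp [hs₁])
  rw [Category.id_comp] at hσ₁
  rw [Category.assoc, hs₂, Category.comp_id] at hσ₂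
  obtain ⟨t, ht₁, ht₂⟩ := euclid (pullback.fst r₂ r₁ ≫ σ) (pullback.snd r₂ r₁)
    (by rw [Category.assoc, hσ₁, pullback.condition])
  exact ⟨⟨{
    toJointlyMono₂ := h
    r := s
    reflexivity₁ := hs₁
    reflexivity₂ := hs₂
    s := σ
    symmetry₁ := hσ₁
    symmetry₂ := hσ₂
    c := _
    isLimit := pullbackIsPullback r₂ r₁
    t := t
    transitivity₁ := ht₁.trans (by rw [Category.assoc, hσ₂]; rfl)
    transitivity₂ := ht₂ }⟩⟩

end Malcev

/-! ### Monadicity of the kernel functors -/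

section Monadicity

variable {C : Type u} [Category.{v} C] [HasZeroMorphisms C] [IsSemiAbelian C]

theorem isRegularEpi_of_isPullback {X Y Z W : C} {f : W ⟶ X} {g : W ⟶ Y} {h : X ⟶ Z}
    {k : Y ⟶ Z} (H : IsPullback f g h k) (hh : IsRegularEpi h) : IsRegularEpi g :=
  Regular.regularEpiIsStableUnderBaseChange.of_isPullback H hh

/-- A reflexive pair in a semi-abelian category is covered by the kernel pair of its
coequalizer. -/
theorem exists_coequalizer_of_reflexive {X Y : C} (f g : X ⟶ Y) (s : Y ⟶ X) (hf : s ≫ f = 𝟙 Y)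
    (hg : s ≫ g = 𝟙 Y) : ∃ (Z R : C) (q : Y ⟶ Z) (e : X ⟶ R) (r₁ r₂ : R ⟶ Y), IsRegularEpi q ∧
      IsRegularEpi e ∧ e ≫ r₁ = f ∧ e ≫ r₂ = g ∧ IsKernelPair q r₁ r₂ := by
  let F := Regular.strongEpiMonoFactorisation (prod.lift f g)
  let r₁ := F.m ≫ prod.fst
  let r₂ := F.m ≫ prod.snd
  have he : IsRegularEpi F.e := inferInstance
  have h₁ : F.e ≫ r₁ = f := by
    rw [← Category.assoc, F.fac, prod.lift_fst]
  have h₂ : F.e ≫ r₂ = g := by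
    rw [← Category.assoc, F.fac, prod.lift_snd]
  have hjm : JointlyMono₂ r₁ r₂ := ⟨fun _ a b hab₁ hab₂ => by
    rw [← cancel_mono F.m]
    apply Limits.prod.hom_ext <;> simpa⟩
  obtain ⟨Z, q, hq⟩ := IsBarrExact.effective r₁ r₂ (isEquivalenceRelation_of_reflexive hjm
    (s ≫ F.e) (by rw [Category.assoc, h₁, hf]) (by rw [Category.assoc, h₂, hg]))
  -- Effectiveness does not make `q` a regular epimorphism; its regular epi part has the same kernel
  -- pair.
  let G := Regular.strongEpiMonoFactorisation q
  have hG : IsRegularEpi G.e := inferInstance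
  have hq' : IsKernelPair (G.e ≫ G.m) r₁ r₂ := by rwa [G.fac]
  exact ⟨_, _, G.e, F.e, r₁, r₂, hG, he, h₁, h₂, hq'.cancel_right_of_mono⟩

/-- Reflexive pairs of points have a coequalizer that is preserved by the kernel functor. -/
theorem Pt.exists_coequalizer {A : C} {P Q : Pt A} (f g : P ⟶ Q) [IsReflexivePair f g] :
    ∃ (Z : Pt A) (q : Q ⟶ Z) (w : f ≫ q = g ≫ q), Nonempty (IsColimit (Cofork.ofπ q w)) ∧
      IsRegularEpi ((kernelFunctor A).map q) ∧
      Nonempty (IsColimit (Cofork.ofπ (f := (kernelFunctor A).map f)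
        (g := (kernelFunctor A).map g) ((kernelFunctor A).map q)
        (by rw [← Functor.map_comp, w, Functor.map_comp]))) := by
  obtain ⟨Z, R, q, e, r₁, r₂, hq, he, hf, hg, hR⟩ := exists_coequalizer_of_reflexive f.hom g.hom
    (commonSection f g).hom (congrArg Pt.Hom.hom (section_comp_left f g))
    (congrArg Pt.Hom.hom (section_comp_right f g))
  have : Epi e := inferInstance
  have : Epi q := inferInstance
  have key {W : C} (k : Q.dom ⟶ W) (hk : f.hom ≫ k = g.hom ≫ k) : ∃ l : Z ⟶ W, q ≫ l = k :=
    IsRegularEpi.exists_of_isKernelPair q hR k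
      (by rw [← cancel_epi e, reassoc_of% hf, reassoc_of% hg, hk])
  obtain ⟨p, hp⟩ := key Q.proj (by rw [Pt.hom_proj, Pt.hom_proj])
  have hfg : f.hom ≫ q = g.hom ≫ q := by rw [← hf, ← hg, Category.assoc, hR.w, Category.assoc]
  let Z' : Pt A := ⟨Z, p, Q.sec ≫ q, by rw [Category.assoc, hp, Q.sec_proj]⟩
  let q' : Q ⟶ Z' := ⟨q, hp, rfl⟩
  have hw : f ≫ q' = g ≫ q' := Pt.hom_ext hfg
  have hq' : IsRegularEpi ((kernelFunctor A).map q') :=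
    isRegularEpi_of_isPullback (isPullback_kernelFunctor_map q') hq
  refine ⟨Z', q', hw, ⟨Cofork.IsColimit.ofExistsUnique fun s => ?_⟩, hq',
    ⟨Cofork.IsColimit.ofExistsUnique fun s => ?_⟩⟩
  · obtain ⟨l, hl⟩ := key s.π.hom (congrArg Pt.Hom.hom s.condition)
    refine ⟨⟨l, ?_, ?_⟩, Pt.hom_ext hl, fun m hm => Pt.hom_ext ?_⟩
    · rw [← cancel_epi q, reassoc_of% hl, Pt.hom_proj]
      exact hp.symm
    · change (Q.sec ≫ q) ≫ l = _
      rw [Category.assoc, hl, Pt.sec_hom]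
    · rw [← cancel_epi q]
      exact (congrArg Pt.Hom.hom hm).trans hl.symm
  -- Two elements `a`, `b` of the kernel identified by `q` form an element of `R`, which after the
  -- cover `y` lifts along `e` to `x` in `P`. As `f` sends `x` into the kernel of `Q`, `x` is in the
  -- kernel of `P`. So the restrictions of `f` and `g` cover the kernel pair of the restricted `q'`.
  · have hK := IsKernelPair.of_hasPullback ((kernelFunctor A).map q')
    have hs : (kernelFunctor A).map f ≫ s.π = (kernelFunctor A).map g ≫ s.π := s.condition
    set a := pullback.fst ((kernelFunctor A).map q') ((kernelFunctor A).map q')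
    set b := pullback.snd ((kernelFunctor A).map q') ((kernelFunctor A).map q')
    have hab : (a ≫ kernelFunctorι Q) ≫ q = (b ≫ kernelFunctorι Q) ≫ q := by
      have := kernelFunctor_map_ι q'
      rw [Category.assoc, Category.assoc]
      change a ≫ _ ≫ q'.hom = b ≫ _ ≫ q'.hom
      rw [← this, ← Category.assoc, hK.w, Category.assoc]
    let n := hR.lift _ _ hab
    have hM := IsPullback.of_hasPullback e n
    have hM' : IsRegularEpi (pullback.snd e n) := isRegularEpi_of_isPullback hM he
    set x := pullback.fst e n
    set y := pullback.snd e n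
    have hxf : x ≫ f.hom = y ≫ a ≫ kernelFunctorι Q := by
      rw [← hf, ← Category.assoc, hM.w, Category.assoc, hR.lift_fst]
    have hxg : x ≫ g.hom = y ≫ b ≫ kernelFunctorι Q := by
      rw [← hg, ← Category.assoc, hM.w, Category.assoc, hR.lift_snd]
    obtain ⟨v, hv⟩ := kernelFunctor_exists_lift (P := P) x (by
      rw [← Pt.hom_proj f, reassoc_of% hxf, kernelFunctorι_proj]
      simp)
    have hva : v ≫ (kernelFunctor A).map f = y ≫ a := by
      rw [← cancel_mono (kernelFunctorι Q), Category.assoc, kernelFunctor_map_ι,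
        reassoc_of% hv, hxf, Category.assoc]
    have hvb : v ≫ (kernelFunctor A).map g = y ≫ b := by
      rw [← cancel_mono (kernelFunctorι Q), Category.assoc, kernelFunctor_map_ι,
        reassoc_of% hv, hxg, Category.assoc]
    have : Epi y := inferInstance
    have : Epi ((kernelFunctor A).map q') := inferInstance
    obtain ⟨l, hl⟩ := IsRegularEpi.exists_of_isKernelPair _ hK s.π (by
      rw [← cancel_epi y, ← reassoc_of% hva, ← reassoc_of% hvb, hs])
    exact ⟨l, hl, fun m hm => by
      rw [← cancel_epi ((kernelFunctor A).map q'), hl]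
      exact hm⟩

/-- The kernel functors of a semi-abelian category are monadic. -/
theorem isEquivalence_comparison_freePtAdj (A : C) :
    (Monad.comparison (freePtAdj A)).IsEquivalence := by
  have : HasReflexiveCoequalizers (Pt A) := ⟨fun _ _ f g _ => by
    obtain ⟨Z, q, w, ⟨h⟩, -⟩ := Pt.exists_coequalizer f g
    exact ⟨_, h⟩⟩
  have : Monad.PreservesColimitOfIsReflexivePair (kernelFunctor A) := ⟨fun _ _ f g _ => by
    obtain ⟨Z, q, w, ⟨h⟩, -, ⟨h'⟩⟩ := Pt.exists_coequalizer f g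
    exact preservesColimit_of_preserves_colimit_cocone h
      ((isColimitMapCoconeCoforkEquiv (kernelFunctor A) w).symm h')⟩
  exact (Monad.monadicOfHasPreservesReflexiveCoequalizersOfReflectsIsomorphisms
    (freePtAdj A)).eqv

end Monadicity

/-! ### Actions as points -/

section ActionsAndPoints

variable {C : Type u} [Category.{v} C] [HasZeroMorphisms C]

theorem IsEquivariant.comp [HasKernels C] [HasBinaryCoproducts C] {A X Y Z : C}
    {ζ : InternalAction A X} {ξ : InternalAction A Y} {θ : InternalAction A Z} {f : X ⟶ Y}
    {g : Y ⟶ Z} (hf : IsEquivariant ζ ξ f) (hg : IsEquivariant ξ θ g) :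
    IsEquivariant ζ θ (f ≫ g) := by
  unfold IsEquivariant at *
  rw [Functor.map_comp, Category.assoc, hg, reassoc_of% hf]

theorem IsEquivariant.inv [HasKernels C] [HasBinaryCoproducts C] {A X Y : C}
    {ζ : InternalAction A X} {ξ : InternalAction A Y} {i : X ≅ Y}
    (h : IsEquivariant ζ ξ i.hom) : IsEquivariant ξ ζ i.inv := by
  unfold IsEquivariant at *
  rw [← cancel_mono i.hom, Category.assoc, ← h, ← Functor.map_comp_assoc]
  simp

/-- The canonical action on the kernel of a point. -/
noncomputable def Pt.action [HasKernels C] [HasBinaryCoproducts C] {A : C} (P : Pt A) :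
    InternalAction A ((kernelFunctor A).obj P) where
  act := ((Monad.comparison (freePtAdj A)).obj P).a
  unit := ((Monad.comparison (freePtAdj A)).obj P).unit
  assoc := ((Monad.comparison (freePtAdj A)).obj P).assoc

theorem Pt.isEquivariant_map [HasKernels C] [HasBinaryCoproducts C] {A : C} {P Q : Pt A}
    (φ : P ⟶ Q) : IsEquivariant P.action Q.action ((kernelFunctor A).map φ) :=
  ((Monad.comparison (freePtAdj A)).map φ).h

variable [IsSemiAbelian C] {A : C}

/-- Every action is, up to isomorphism, the canonical action of a point: its semidirect product. -/
theorem InternalAction.exists_point {X : C} (ξ : InternalAction A X) :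
    ∃ (P : Pt A) (i : (kernelFunctor A).obj P ≅ X), IsEquivariant P.action ξ i.hom := by
  have := isEquivalence_comparison_freePtAdj A
  let α : (freePtAdj A).toMonad.Algebra := ⟨X, ξ.act, ξ.unit, ξ.assoc⟩
  let j := (Monad.comparison (freePtAdj A)).objObjPreimageIso α
  exact ⟨_, ((freePtAdj A).toMonad.forget).mapIso j, j.hom.h⟩

/-- This is fullness of the comparison functor. -/
theorem Pt.exists_hom {P Q : Pt A} (k : (kernelFunctor A).obj P ⟶ (kernelFunctor A).obj Q)
    (hk : IsEquivariant P.action Q.action k) : ∃ φ : P ⟶ Q, (kernelFunctor A).map φ = k := by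
  have := isEquivalence_comparison_freePtAdj A
  let κ : (Monad.comparison (freePtAdj A)).obj P ⟶ (Monad.comparison (freePtAdj A)).obj Q :=
    ⟨k, hk⟩
  obtain ⟨φ, hφ⟩ := (Monad.comparison (freePtAdj A)).map_surjective κ
  exact ⟨φ, congrArg Monad.Algebra.Hom.f hφ⟩

instance : (kernelFunctor A).Faithful where
  map_injective {P Q φ ψ} h := by
    have := isEquivalence_comparison_freePtAdj A
    exact (Monad.comparison (freePtAdj A)).map_injective (Monad.Algebra.Hom.ext h)

instance : PreservesLimitsOfSize.{0, 0} (kernelFunctor A) :=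
  (freePtAdj A).rightAdjoint_preservesLimits

instance : PreservesFiniteLimits (kernelFunctor A) :=
  PreservesLimitsOfSize.preservesFiniteLimits _

end ActionsAndPoints

/-! ### Normal monomorphisms of points and quotient actions -/

section StronglyProtomodular

variable {C : Type u} [Category.{v} C] [HasZeroMorphisms C]

theorem IsShortExact.of_iso [Regular C] {X Y Z X' Y' : C} {f : X ⟶ Y} {g : Y ⟶ Z}
    (h : IsShortExact f g) (i : X ≅ X') (j : Y ≅ Y') {f' : X' ⟶ Y'}
    (w : f ≫ j.hom = i.hom ≫ f') : IsShortExact f' (j.inv ≫ g) := by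
  obtain ⟨hg, w₀, ⟨hf⟩⟩ := h
  have hf' : f' = i.inv ≫ f ≫ j.hom := by simp [w]
  have key {W : C} (k : W ⟶ Y') (hk : k ≫ j.inv ≫ g = 0) : ∃ l : W ⟶ X', l ≫ f' = k := by
    obtain ⟨l, hl⟩ := KernelFork.IsLimit.lift' hf (k ≫ j.inv) (by rw [Category.assoc, hk])
    change l ≫ f = _ at hl
    exact ⟨l ≫ i.hom, by rw [hf', Category.assoc, i.hom_inv_id_assoc, reassoc_of% hl]; simp⟩
  have : Mono f := mono_of_isLimit_fork hf
  have : Mono f' := by rw [hf']; infer_instance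
  choose l hl using @key
  refine ⟨Regular.regularEpiIsStableUnderBaseChange.of_isPullback (f := 𝟙 Z) (g := g)
    (f' := j.inv) (g' := j.inv ≫ g) (IsPullback.of_horiz_isIso ⟨by simp⟩) hg, by simp [hf', w₀],
    ⟨KernelFork.IsLimit.ofι _ _ (fun k hk => l k hk) (fun k hk => hl k hk)
      (fun k hk m hm => by rw [← cancel_mono f', hm, hl])⟩⟩

variable [IsSemiAbelian C] {A : C}

/-- Normality on kernels does not see `g`, because pullback leaves kernels unchanged up to natural
isomorphism. -/
theorem isNormalMono_changeOfBase_comp_iff {E : C} (g : E ⟶ A) {P Q : Pt A} (φ : P ⟶ Q) :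
    IsNormalMono ((kernelFunctor E).map ((changeOfBase g).map φ)) ↔
      IsNormalMono ((kernelFunctor A).map φ) := by
  obtain ⟨ν⟩ := nonempty_changeOfBase_comp_kernelFunctor_iso g
  exact ⟨fun h => h.of_iso (ν.app P) (ν.app Q) (ν.hom.naturality φ),
    fun h => h.of_iso (ν.app P).symm (ν.app Q).symm (ν.inv.naturality φ)⟩

/-- In a strongly protomodular category the kernel functors reflect normal monomorphisms. -/
theorem IsStronglyProtomodular.isNormalMono_of_kernelFunctor (h : IsStronglyProtomodular C)
    {P Q : Pt A} (φ : P ⟶ Q) (hφ : IsNormalMono ((kernelFunctor A).map φ)) : IsNormalMono φ := by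
  obtain ⟨O, hO⟩ := HasZeroObject.zero (C := C)
  have := isEquivalence_kernelFunctor_of_isZero hO
  exact (h (0 : O ⟶ A)).reflects_normalMono φ
    (((isNormalMono_changeOfBase_comp_iff _ φ).2 hφ).of_map_of_isEquivalence (kernelFunctor O))

/-- The image under the kernel functor of a normal monomorphism of points is the kernel of the
image of a morphism of points. -/
theorem IsNormalMono.exists_isShortExact {P Q : Pt A} {φ : P ⟶ Q} (h : IsNormalMono φ) :
    ∃ (Z : Pt A) (q : Q ⟶ Z), IsShortExact ((kernelFunctor A).map φ) ((kernelFunctor A).map q) := by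
  obtain ⟨_, R, r₁, r₂, hR, hφ⟩ := h
  have : IsReflexivePair r₁ r₂ := by
    obtain ⟨⟨e⟩⟩ := hR
    exact IsReflexivePair.mk' e.r e.reflexivity₁ e.reflexivity₂
  obtain ⟨Z, q, w, -, hq, ⟨hc⟩⟩ := Pt.exists_coequalizer r₁ r₂
  -- The image of `R` is the kernel pair of some `q₀`, whose codomain need not come from a point.
  -- Since `q₀` factors through the image of `q`, the latter has the same kernel pair.
  obtain ⟨Z₀, q₀, hq₀⟩ := IsBarrExact.effective _ _ (isEquivalenceRelation_map (kernelFunctor A) hR)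
  obtain ⟨l, hl⟩ := Cofork.IsColimit.desc' hc q₀ hq₀.w
  change (kernelFunctor A).map q ≫ l = q₀ at hl
  have hk : IsKernelPair ((kernelFunctor A).map q) ((kernelFunctor A).map r₁)
      ((kernelFunctor A).map r₂) := by
    rw [← hl] at hq₀
    exact hq₀.cancel_right (by rw [← Functor.map_comp, w, Functor.map_comp])
  exact ⟨Z, q, hq, (hφ.map (kernelFunctor A)).isLimit_kernelFork hk⟩

/-- A morphism of points is a normal monomorphism as soon as its image under the kernel functor is
the kernel of an equivariant morphism. -/
theorem Pt.isNormalMono_of_isShortExact {P Q : Pt A} (φ : P ⟶ Q) {Z : C}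
    {g : (kernelFunctor A).obj Q ⟶ Z} (h : IsShortExact ((kernelFunctor A).map φ) g)
    {ζ : InternalAction A Z} (hg : IsEquivariant Q.action ζ g) : IsNormalMono φ := by
  obtain ⟨-, w, ⟨hl⟩⟩ := h
  obtain ⟨Z', i, hi⟩ := ζ.exists_point
  obtain ⟨γ, hγ⟩ := Pt.exists_hom (g ≫ i.inv) (hg.comp hi.inv)
  have hO : IsZero ((kernelFunctor A).obj (Pt.zero A)) := by
    rw [IsZero.iff_id_eq_zero, ← cancel_mono (kernelFunctorι _)]
    rw [zero_comp, Category.id_comp]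
    exact (Category.comp_id _).symm.trans (kernelFunctorι_proj (Pt.zero A))
  let a : P ⟶ Pt.zero A := (Pt.isZero_zero A).from_ P
  let b : Pt.zero A ⟶ Z' := (Pt.isZero_zero A).to_ Z'
  have hb : (kernelFunctor A).map b = 0 := hO.eq_of_src _ _
  have hw : φ ≫ γ = a ≫ b := by
    apply (kernelFunctor A).map_injective
    rw [Functor.map_comp, Functor.map_comp, hb, hγ, reassoc_of% w, zero_comp, comp_zero]
  -- A conservative functor preserving a limit that exists reflects it. So it suffices that the
  -- image square is a pullback, and it is: the zero point has zero kernel.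
  have : ReflectsLimit (cospan γ b) (kernelFunctor A) :=
    reflectsLimit_of_reflectsIsomorphisms _ _
  refine IsNormalMono.of_isPullback_of_isZero (Pt.isZero_zero A)
    (IsPullback.of_map (kernelFunctor A) hw ?_)
  have : Mono ((kernelFunctor A).map φ) := mono_of_isLimit_fork hl
  have key {T : C} (k : T ⟶ (kernelFunctor A).obj Q) (c : T ⟶ (kernelFunctor A).obj (Pt.zero A))
      (hk : k ≫ (kernelFunctor A).map γ = c ≫ (kernelFunctor A).map b) :
      ∃ l : T ⟶ (kernelFunctor A).obj P, l ≫ (kernelFunctor A).map φ = k := by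
    obtain ⟨l, hl⟩ := KernelFork.IsLimit.lift' hl k (by
      rw [← cancel_mono i.inv, Category.assoc, ← hγ, hk, hb, comp_zero, zero_comp])
    exact ⟨l, hl⟩
  choose l hl using @key
  exact ⟨⟨by rw [← Functor.map_comp, hw, Functor.map_comp]⟩, ⟨PullbackCone.IsLimit.mk _
    (fun s => l s.fst s.snd s.condition) (fun s => hl _ _ _) (fun s => hO.eq_of_tgt _ _)
    (fun s m h₁ h₂ => by rw [← cancel_mono ((kernelFunctor A).map φ), h₁, hl])⟩⟩

end StronglyProtomodular

end InternalActions

/-! ### The equivalence -/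

open InternalActions
theorem theorem5p3 {C : Type*} [Category* C] [HasZeroMorphisms C] [IsSemiAbelian C] :
    IsStronglyProtomodular C ↔
      ∀ (A Y : C) (ξ : InternalAction A Y) (X : C) (f : X ⟶ Y),
        IsNormalMono f → ξ.Restricts f → ξ.PassesToQuotient f := by
  refine ⟨fun h A Y ξ X f hf ⟨ζ, hζ⟩ => ?_, fun h E A g => ⟨inferInstance, ⟨fun {P Q} φ _ => ?_⟩,
    fun P Q φ hφ => ?_⟩⟩
  · obtain ⟨P, i, hi⟩ := ζ.exists_point
    obtain ⟨Q, j, hj⟩ := ξ.exists_point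
    obtain ⟨φ, hφ⟩ := Pt.exists_hom (i.hom ≫ f ≫ j.inv) (hi.comp (hζ.comp hj.inv))
    have hφf : (kernelFunctor A).map φ ≫ j.hom = i.hom ≫ f := by rw [hφ]; simp
    obtain ⟨Z, q, hq⟩ := (h.isNormalMono_of_kernelFunctor φ
      (hf.of_iso i.symm j.symm (by rw [hφ]; simp))).exists_isShortExact
    exact ⟨_, _, hq.of_iso i j hφf, Z.action, hj.inv.comp (Pt.isEquivariant_map q)⟩
  · obtain ⟨ν⟩ := nonempty_changeOfBase_comp_kernelFunctor_iso g
    have : IsIso ((changeOfBase g ⋙ kernelFunctor E).map φ) :=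
      inferInstanceAs (IsIso ((kernelFunctor E).map ((changeOfBase g).map φ)))
    have : IsIso ((kernelFunctor A).map φ) := (NatIso.isIso_map_iff ν φ).1 this
    exact isIso_of_reflects_iso φ (kernelFunctor A)
  -- Normality of the pulled back `φ` descends to kernels by left exactness, and `φ` itself supplies
  -- the restricted action.
  · obtain ⟨Z, q, hq, ζ, hζ⟩ := h A _ Q.action _ ((kernelFunctor A).map φ)
      ((isNormalMono_changeOfBase_comp_iff g φ).1 (hφ.map (kernelFunctor E)))
      ⟨P.action, Pt.isEquivariant_map φ⟩
    exact Pt.isNormalMono_of_isShortExact φ hq hζ
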